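/- Let $X$ be a Tychonoff space, and let $C_p(X)$ be the set $C(X)$ of continuous real-valued functions on $X$ with the topology of pointwise convergence. Then the following statements are equivalent: 1. $C_p(X)$ satisfies $U_{fin}(\mathcal S,\mathcal D)$ and is sequentially separable; 2. $X$ satisfies $U_{fin}(\Gamma_F,\Omega)$ and has property $V$; 3. $C_p(X)$ satisfies $U_{fin}(\Gamma_x,\Omega_x)$ and is sequentially separable; 4. $C_p(X)$ satisfies $U_{fin}(\mathcal S,\Omega_x)$ and is sequentially separable. Definitions. *Sequential density.* A subset $D$ of a space $E$ is sequentially dense if every point of $E$ is the limit of a sequence of points of $D$; $\mathcal S$ is the family of sequentially dense subsets; $E$ is sequentially separable if it has a countable sequentially dense subset. *Covers.* A cover $\mathcal U$ of $X$ is a family of subsets of $X$ with $\bigcup\mathcal U=X$ and $X\notin\mathcal U$. It is a $\gamma$-cover if it is infinite and each $x\in X$ belongs to all but finitely many members of $\mathcal U$; it is an $\omega$-cover if each finite subset of $X$ is contained in a member of $\mathcal U$. $\Omega$ is the family of $\omega$-covers of $X$ by open sets. A zero-set is a set $f^{-1}(0)$ with $f\in C(X)$, and a cozero-set is the complement of a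 zero-set. $\Gamma_F$ is the family of $\gamma$-covers $\mathcal U$ of $X$ by cozero-sets for which there is a $\gamma$-cover $\{F(U):U\in\mathcal U\}$ of $X$ by zero-sets with $F(U)\subseteq U$ for all $U\in\mathcal U$. $X$ satisfies $U_{fin}(\Gamma_F,\Omega)$ if for every sequence $(\mathcal U_n)_{n\in\mathbb N}$ in $\Gamma_F$ such that no $\mathcal U_n$ has a finite subfamily with union $X$, there are finite $\mathcal F_n\subseteq\mathcal U_n$ with $\{\bigcup\mathcal F_n:n\in\mathbb N\}\in\Omega$. *Property $V$.* There is a continuous bijection $f:X\to Y$ onto a separable metric space $Y$ such that $f(U)$ is an $F_\sigma$-set in $Y$ for every cozero-set $U\subseteq X$. *Selection in $C_p(X)$.* For $f\in C(X)$, let $\Gamma_f$ be the family of infinite sets $A\subseteq C(X)$ with $f\notin A$ such that $A\setminus W$ is finite for every neighbourhood $W$ of $f$ in $C_p(X)$. For a sequence $(\mathcal F_n)_{n\in\mathbb N}$ of finite subsets of $C(X)$, write $\{\bigcup\mathcal F_n:n\in\mathbb N\}\in\Omega_f$ if for every finite $K\subseteq X$ and every $\varepsilon>0$ there is an $n$ such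 that for each $x\in K$ there is $g\in\mathcal F_n$ with $|g(x)-f(x)|<\varepsilon$; write $\{\bigcup\mathcal F_n:n\in\mathbb N\}\in\mathcal D$ if this holds for every $f\in C(X)$. $C_p(X)$ satisfies $U_{fin}(\mathcal S,\mathcal D)$ if for every sequence $(A_n)_{n\in\mathbb N}$ of sequentially dense subsets of $C_p(X)$ there are finite $\mathcal F_n\subseteq A_n$ with $\{\bigcup\mathcal F_n:n\in\mathbb N\}\in\mathcal D$. It satisfies $U_{fin}(\Gamma_x,\Omega_x)$ (respectively $U_{fin}(\mathcal S,\Omega_x)$) if for every $f\in C(X)$ and every sequence $(A_n)_{n\in\mathbb N}$ of members of $\Gamma_f$ (respectively of sequentially dense subsets of $C_p(X)$) there are finite $\mathcal F_n\subseteq A_n$ with $\{\bigcup\mathcal F_n:n\in\mathbb N\}\in\Omega_f$. -/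

import Mathlib

namespace SelectionCp

universe u

section Covers

variable {X : Type u} [TopologicalSpace X]

/-- Zero-sets of `X`: preimages of `0` under continuous real-valued functions. -/
def IsZeroSet (Z : Set X) : Prop := ∃ f : X → ℝ, Continuous f ∧ Z = f ⁻¹' {0}

/-- Cozero-sets of `X`: complements of zero-sets. -/
def IsCozeroSet (U : Set X) : Prop := IsZeroSet Uᶜ

/-- `F_σ`-sets: countable unions of closed sets. -/
def IsFSigma (A : Set X) : Prop := ∃ C : ℕ → Set X, (∀ n, IsClosed (C n)) ∧ A = ⋃ n, C n

/-- Nontrivial covers: the whole space is the union of the family, but is not a member of it. -/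
def IsNontrivialCover (𝒰 : Set (Set X)) : Prop := ⋃₀ 𝒰 = Set.univ ∧ Set.univ ∉ 𝒰

/-- `γ`-covers (by arbitrary sets): infinite nontrivial covers such that each point belongs to
all but finitely many members. -/
def IsGammaCover (𝒰 : Set (Set X)) : Prop :=
  IsNontrivialCover 𝒰 ∧ 𝒰.Infinite ∧ ∀ x : X, {U ∈ 𝒰 | x ∉ U}.Finite

variable (X) in
/-- `Ω`: the family of open `ω`-covers of `X`. -/
def OmegaCovers : Set (Set (Set X)) :=
  {𝒰 | IsNontrivialCover 𝒰 ∧ (∀ U ∈ 𝒰, IsOpen U) ∧ ∀ K : Finset X, ∃ U ∈ 𝒰, (K : Set X) ⊆ U}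

variable (X) in
/-- `Γ_F`: the family of `γ_F`-shrinkable `γ`-covers of `X`, that is, the `γ`-covers `𝒰` by
cozero-sets for which there is a `γ`-cover `{F U | U ∈ 𝒰}` by zero-sets with `F U ⊆ U`. -/
def GammaFCovers : Set (Set (Set X)) :=
  {𝒰 | IsGammaCover 𝒰 ∧ (∀ U ∈ 𝒰, IsCozeroSet U) ∧
    ∃ F : Set X → Set X, (∀ U ∈ 𝒰, IsZeroSet (F U) ∧ F U ⊆ U) ∧ IsGammaCover (F '' 𝒰)}

/-- The selection principle `U_fin(𝒜, ℬ)` for families `𝒜`, `ℬ` of covers of `X`. -/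
def UFinCovers (𝒜 ℬ : Set (Set (Set X))) : Prop :=
  ∀ 𝒰 : ℕ → Set (Set X), (∀ n, 𝒰 n ∈ 𝒜) →
    (∀ n, ∀ ℱ ⊆ 𝒰 n, ℱ.Finite → ⋃₀ ℱ ≠ Set.univ) →
    ∃ ℱ : ℕ → Set (Set X), (∀ n, (ℱ n).Finite ∧ ℱ n ⊆ 𝒰 n) ∧
      Set.range (fun n => ⋃₀ ℱ n) ∈ ℬ

variable (X) in
/-- Property `V`: there is a condensation (continuous bijection) of `X` onto a separable metric
space that maps cozero-sets to `F_σ`-sets. (A space in bijection with `X` may be taken in the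
universe of `X`.) -/
def PropertyV : Prop :=
  ∃ (Y : Type u) (_ : MetricSpace Y) (_ : TopologicalSpace.SeparableSpace Y) (f : X → Y),
    Continuous f ∧ Function.Bijective f ∧ ∀ U : Set X, IsCozeroSet U → IsFSigma (f '' U)

end Covers

section SequentialDensity

variable {E : Type u} [TopologicalSpace E]

/-- Sequentially dense sets: every point of the space is the limit of a sequence from the set. -/
def IsSeqDense (D : Set E) : Prop := seqClosure D = Set.univ

variable (E) in
/-- `𝒮`: the family of sequentially dense sets. -/
def SeqDenseSets : Set (Set E) := {D | IsSeqDense D}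

variable (E) in
/-- Sequentially separable spaces: there is a countable sequentially dense set. -/
def IsSeqSeparable : Prop := ∃ D : Set E, D.Countable ∧ IsSeqDense D

/-- `Γ_x`: the family of sets converging to the point `x`, that is, infinite sets `A` with
`x ∉ A` such that `A \ U` is finite for every neighbourhood `U` of `x`. -/
def GammaAt (x : E) : Set (Set E) :=
  {A | A.Infinite ∧ x ∉ A ∧ ∀ U ∈ nhds x, (A \ U).Finite}

end SequentialDensity

section FunctionSpace

/-- `C_p(X)`: continuous real-valued functions on `X`, with the topology of pointwise convergence
(the topology of a subspace of the product `X → ℝ`). -/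
abbrev Cp (X : Type u) [TopologicalSpace X] : Type u := {f : X → ℝ // Continuous f}

variable {X : Type u} [TopologicalSpace X]

/-- The meaning of `{⋃ ℱ n | n ∈ ℕ} ∈ Ω_f` in `U_fin`-principles for `C_p(X)`: for each basic
neighbourhood `⟨f, K, ε⟩` of `f` there is an `n` such that at each point of `K` some member of
`ℱ n` is `ε`-close to `f`. -/
def OmegaAt (f : Cp X) : Set (ℕ → Set (Cp X)) :=
  {ℱ | ∀ K : Finset X, ∀ ε : ℝ, 0 < ε → ∃ n, ∀ x ∈ K, ∃ g ∈ ℱ n, |g.1 x - f.1 x| < ε}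

variable (X) in
/-- The meaning of `{⋃ ℱ n | n ∈ ℕ} ∈ 𝒟` in `U_fin`-principles for `C_p(X)`. -/
def DenseSequences : Set (ℕ → Set (Cp X)) := {ℱ | ∀ f : Cp X, ℱ ∈ OmegaAt f}

/-- The selection principle `U_fin(𝒜, ℬ)` for `C_p(X)`. -/
def UFinCp (𝒜 : Set (Set (Cp X))) (ℬ : Set (ℕ → Set (Cp X))) : Prop :=
  ∀ A : ℕ → Set (Cp X), (∀ n, A n ∈ 𝒜) →
    ∃ ℱ : ℕ → Set (Cp X), (∀ n, (ℱ n).Finite ∧ ℱ n ⊆ A n) ∧ ℱ ∈ ℬ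

end FunctionSpace

end SelectionCp

/-! The equivalence splits into two independent translations.

Sequential separability of `Cp X` amounts to property V. A countable sequentially dense set
evaluates `X` injectively into a countable power of ℝ, and a cozero-set becomes F_σ there because
g(x) ≠ 0 exactly when a sequence converging to g is eventually bounded away from 0 at x. Conversely,
countably many continuous functions on `Y` cut out all its closed sets; the countable
lattice-ordered ring they generate, pulled back to `X`, reaches every continuous g: approximate g
uniformly by functions that are constant on countably many closed pieces, then pass to one sequence
by truncating increments (`exists_tendsto_of_uniform_approx`).

The selection principles correspond through functions and sets. A shrinkable γ-cover yields
functions tending to 0 that equal 1 off its members; deforming a sequentially dense set by them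
keeps it sequentially dense, and coming within 1 of the zero function then means lying in a chosen
member (`uFinCovers_of_seqDenseSets`). Conversely, if u_i → f, the sets where |u_i - f| < δ form a
γ-cover shrunk by the condition ≤ δ/2 (`uFinCp_gammaAt_of_uFinCovers`). A countable sequentially
dense set upgrades selection at each f to all f at once. -/

open Filter Topology

namespace SelectionCp

universe v

/-! ### Pointwise convergence and the families Γ_f -/

section Convergence

variable {X : Type v} [TopologicalSpace X]

theorem tendsto_cp_iff {ι : Type*} {l : Filter ι} {u : ι → Cp X} {g : Cp X} :
    Tendsto u l (𝓝 g) ↔ ∀ x, Tendsto (fun i => (u i).1 x) l (𝓝 (g.1 x)) := by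
  rw [tendsto_subtype_rng, tendsto_pi_nhds]

theorem isSeqDense_cp_iff {D : Set (Cp X)} :
    IsSeqDense D ↔ ∀ g : Cp X, ∃ u : ℕ → Cp X, (∀ n, u n ∈ D) ∧
      ∀ x, Tendsto (fun n => (u n).1 x) atTop (𝓝 (g.1 x)) := by
  simp only [IsSeqDense, Set.eq_univ_iff_forall, seqClosure, Set.mem_ofPred_eq, tendsto_cp_iff]

theorem range_mem_gammaAt {E : Type v} [TopologicalSpace E] [T1Space E] {u : ℕ → E} {a : E}
    (hu : Tendsto u atTop (𝓝 a)) (hne : ∀ n, u n ≠ a) : Set.range u ∈ GammaAt a := by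
  have ha : a ∉ Set.range u := by rintro ⟨n, hn⟩; exact hne n hn
  refine ⟨fun hfin => ha ?_, ha, fun W hW => ?_⟩
  · exact hfin.isClosed.mem_of_tendsto hu (Eventually.of_forall fun n => ⟨n, rfl⟩)
  · obtain ⟨N, hN⟩ := eventually_atTop.1 (hu.eventually_mem hW)
    refine ((Set.finite_lt_nat N).image u).subset ?_
    rintro _ ⟨⟨n, rfl⟩, hn⟩
    exact ⟨n, not_le.1 fun h => hn (hN n h), rfl⟩

theorem exists_seq_of_mem_gammaAt {E : Type v} [TopologicalSpace E] {A : Set E} {a : E}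
    (hA : A ∈ GammaAt a) : ∃ u : ℕ → E, (∀ n, u n ∈ A) ∧ Tendsto u atTop (𝓝 a) := by
  obtain ⟨hinf, -, hW⟩ := hA
  refine ⟨fun n => hinf.natEmbedding A n, fun n => (hinf.natEmbedding A n).2, ?_⟩
  intro W hWa
  rw [mem_map, ← Nat.cofinite_eq_atTop, mem_cofinite]
  refine ((hW W hWa).preimage (f := fun n => (hinf.natEmbedding A n : E)) ?_).subset ?_
  · exact (Subtype.val_injective.comp (hinf.natEmbedding A).injective).injOn
  · intro n hn
    exact ⟨(hinf.natEmbedding A n).2, hn⟩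

end Convergence

/-! ### Shrinkable γ-covers, sequences of sets and of functions -/

section Covers

variable {X : Type v} [TopologicalSpace X]

theorem IsCozeroSet.isOpen {U : Set X} (hU : IsCozeroSet U) : IsOpen U := by
  obtain ⟨f, hf, h⟩ := hU
  rw [← isClosed_compl_iff, h]
  exact isClosed_singleton.preimage hf

/-- The range of a sequence of proper subsets that eventually contains each point is a
`γ`-cover. -/
theorem isGammaCover_range {X : Type v} {S : ℕ → Set X} (hS : ∀ x, ∀ᶠ i in atTop, x ∈ S i)
    (hne : ∀ i, S i ≠ Set.univ) : IsGammaCover (Set.range S) := by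
  refine ⟨⟨?_, ?_⟩, ?_, fun x => ?_⟩
  · refine Set.eq_univ_of_forall fun x => ?_
    obtain ⟨i, hi⟩ := (hS x).exists
    exact ⟨S i, ⟨i, rfl⟩, hi⟩
  · rintro ⟨i, hi⟩
    exact hne i hi
  · intro hfin
    have : Finite (Set.range S) := hfin
    -- With finite range, some value recurs infinitely often and so contains every point.
    obtain ⟨⟨_, j, rfl⟩, hinf⟩ := Finite.exists_infinite_fiber (Set.rangeFactorization S)
    refine hne j (Set.eq_univ_of_forall fun x => ?_)
    obtain ⟨N, hN⟩ := eventually_atTop.1 (hS x)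
    obtain ⟨i, hi, hiN⟩ := (Set.infinite_coe_iff.1 hinf).exists_gt N
    have h : S i = S j := congrArg Subtype.val hi
    exact h ▸ hN i hiN.le
  · obtain ⟨N, hN⟩ := eventually_atTop.1 (hS x)
    refine ((Set.finite_lt_nat N).image S).subset ?_
    rintro _ ⟨⟨n, rfl⟩, hn⟩
    exact ⟨n, not_le.1 fun h => hn (hN n h), rfl⟩

theorem exists_injective_subseq {X : Type v} {S : ℕ → Set X} (hS : ∀ x, ∀ᶠ i in atTop, x ∈ S i)
    (hne : ∀ i, S i ≠ Set.univ) :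
    ∃ φ : ℕ → ℕ, Function.Injective (S ∘ φ) := by
  have hinf := (isGammaCover_range hS hne).2.1
  choose φ hφ using fun n => (hinf.natEmbedding _ n).2
  refine ⟨φ, fun a b hab => ?_⟩
  simp only [Function.comp, hφ] at hab
  exact (hinf.natEmbedding _).injective (Subtype.ext hab)

/-- A shrinking is a function of the set, not of its index; injectivity of `S` makes S i ↦ Z i well
defined. -/
theorem range_mem_gammaFCovers {S Z : ℕ → Set X} (hinj : Function.Injective S)
    (hS : ∀ i, IsCozeroSet (S i)) (hZ : ∀ i, IsZeroSet (Z i)) (hZS : ∀ i, Z i ⊆ S i)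
    (hx : ∀ x, ∀ᶠ i in atTop, x ∈ Z i) (hne : ∀ i, S i ≠ Set.univ) :
    Set.range S ∈ GammaFCovers X := by
  refine ⟨isGammaCover_range (fun x => (hx x).mono fun i hi => hZS i hi) hne,
    Set.forall_mem_range.2 hS, Function.extend S Z fun _ => ∅, Set.forall_mem_range.2 fun i => ?_, ?_⟩
  · rw [hinj.extend_apply]
    exact ⟨hZ i, hZS i⟩
  · rw [← Set.range_comp, Function.extend_comp hinj]
    exact isGammaCover_range hx fun i h => hne i (Set.univ_subset_iff.1 (h ▸ hZS i))

theorem exists_seq_of_mem_gammaFCovers {𝒰 : Set (Set X)} (h𝒰 : 𝒰 ∈ GammaFCovers X) :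
    ∃ (U : ℕ → Set X) (h : ℕ → Cp X), (∀ i, U i ∈ 𝒰) ∧ (∀ i, ∀ x ∉ U i, (h i).1 x = 1) ∧
      ∀ x, ∀ᶠ i in atTop, (h i).1 x = 0 := by
  obtain ⟨-, hcoz, F, hF, -, hinf, hfin⟩ := h𝒰
  -- Enumerating the image of `F` makes the sets F(U n) distinct, so "all but finitely many members"
  -- becomes "eventually in n".
  choose U hU hFU using fun n => (hinf.natEmbedding _ n).2
  have hinj : Function.Injective fun n => F (U n) := fun a b hab => by
    simp only [hFU] at hab
    exact (hinf.natEmbedding _).injective (Subtype.ext hab)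
  choose a ha haU using fun n => hcoz (U n) (hU n)
  choose b hb hbF using fun n => (hF (U n) (hU n)).1
  -- The zero-sets of a i and b i are the complement of U i and F(U i), which are disjoint.
  have hpos : ∀ i x, 0 < |a i x| + |b i x| := fun i x => by
    by_contra! hle
    have h1 : a i x = 0 := abs_eq_zero.1 (by linarith [abs_nonneg (a i x), abs_nonneg (b i x)])
    have h2 : b i x = 0 := abs_eq_zero.1 (by linarith [abs_nonneg (a i x), abs_nonneg (b i x)])
    have h3 : x ∈ (U i)ᶜ := by rw [haU]; exact h1
    have h4 : x ∈ F (U i) := by rw [hbF]; exact h2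
    exact h3 ((hF (U i) (hU i)).2 h4)
  refine ⟨U, fun i => ⟨fun x => |b i x| / (|a i x| + |b i x|), ?_⟩, hU, fun i x hx => ?_,
    fun x => ?_⟩
  · exact (hb i).abs.div ((ha i).abs.add (hb i).abs) fun x => (hpos i x).ne'
  · have h1 : a i x = 0 := by
      have : x ∈ (U i)ᶜ := hx
      rwa [haU] at this
    have h2 := hpos i x
    simp only [h1, abs_zero, zero_add] at h2 ⊢
    exact div_self h2.ne'
  · rw [← Nat.cofinite_eq_atTop]
    have hf : {i | x ∉ F (U i)}.Finite :=
      ((hfin x).preimage (f := fun i => F (U i)) hinj.injOn).subset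
        fun i hi => ⟨⟨U i, hU i, rfl⟩, hi⟩
    refine (eventually_cofinite.2 hf).mono fun i hi => ?_
    rw [hbF] at hi
    have h2 : b i x = 0 := hi
    simp [h2]

end Covers

/-! ### Transfer between selection in `Cp X` and selection of covers -/

section Selection

variable {X : Type v} [TopologicalSpace X]

theorem uFinCp_denseSequences (hsep : IsSeqSeparable (Cp X)) {𝒜 : Set (Set (Cp X))}
    (h : ∀ f : Cp X, UFinCp 𝒜 (OmegaAt f)) : UFinCp 𝒜 (DenseSequences X) := by
  obtain ⟨D, hDc, hD⟩ := hsep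
  rw [isSeqDense_cp_iff] at hD
  have hne : D.Nonempty := by
    obtain ⟨u, hu, -⟩ := hD ⟨0, continuous_zero⟩
    exact ⟨u 0, hu 0⟩
  obtain ⟨d, rfl⟩ := hDc.exists_eq_range hne
  intro A hA
  -- Split ℕ into infinitely many rows; row k serves the target d k.
  choose ℱ hℱ hΩ using fun k => h (d k) (fun m => A (Nat.pair k m)) fun m => hA _
  refine ⟨fun n => ℱ n.unpair.1 n.unpair.2, fun n => ?_, fun f K ε hε => ?_⟩
  · simpa using hℱ n.unpair.1 n.unpair.2
  · obtain ⟨u, hu, hlim⟩ := hD f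
    have hev : ∀ᶠ j in atTop, ∀ x ∈ K, |(u j).1 x - f.1 x| < ε / 2 :=
      (Finset.eventually_all K).2 fun x _ =>
        (Metric.tendsto_nhds.1 (hlim x) (ε / 2) (half_pos hε)).mono fun j hj => by
          rwa [Real.dist_eq] at hj
    obtain ⟨j, hj⟩ := hev.exists
    obtain ⟨k, hk⟩ := hu j
    obtain ⟨m, hm⟩ := hΩ k K (ε / 2) (half_pos hε)
    refine ⟨Nat.pair k m, fun x hx => ?_⟩
    obtain ⟨g, hg, hgx⟩ := hm x hx
    refine ⟨g, by simpa using hg, ?_⟩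
    have h1 := hj x hx
    rw [← hk] at h1
    calc |g.1 x - f.1 x| ≤ |g.1 x - (d k).1 x| + |(d k).1 x - f.1 x| := abs_sub_le _ _ _
      _ < ε := by linarith

theorem uFinCp_seqDenseSets_of_gammaAt (f : Cp X) (h : UFinCp (GammaAt f) (OmegaAt f)) :
    UFinCp (SeqDenseSets (Cp X)) (OmegaAt f) := by
  intro A hA
  -- Members of Γ_f must omit f; if some A n contains f, selecting f itself at stage n suffices.
  by_cases hf : ∃ n, f ∈ A n
  · obtain ⟨n, hn⟩ := hf
    refine ⟨fun m => {g | g = f ∧ m = n}, fun m => ⟨?_, ?_⟩, fun K ε hε => ⟨n, fun x _ => ?_⟩⟩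
    · exact (Set.finite_singleton f).subset fun g hg => hg.1
    · rintro g ⟨rfl, rfl⟩
      exact hn
    · exact ⟨f, ⟨rfl, rfl⟩, by simpa using hε⟩
  · push Not at hf
    choose u hu hlim using fun n => isSeqDense_cp_iff.1 (hA n) f
    obtain ⟨ℱ, hℱ, hΩ⟩ := h (fun n => Set.range (u n)) fun n =>
      range_mem_gammaAt (tendsto_cp_iff.2 (hlim n)) fun m hm => hf n (hm ▸ hu n m)
    exact ⟨ℱ, fun n => ⟨(hℱ n).1, (hℱ n).2.trans (Set.range_subset_iff.2 (hu n))⟩, hΩ⟩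

theorem uFinCovers_of_seqDenseSets (hsep : IsSeqSeparable (Cp X))
    (h : ∀ f : Cp X, UFinCp (SeqDenseSets (Cp X)) (OmegaAt f)) :
    UFinCovers (GammaFCovers X) (OmegaCovers X) := by
  intro 𝒰 h𝒰 hnf
  obtain ⟨D, -, hD⟩ := hsep
  rw [isSeqDense_cp_iff] at hD
  choose U b hU hb1 hb0 using fun n => exists_seq_of_mem_gammaFCovers (h𝒰 n)
  -- Each member is 1 off some U n i, while d(1 - b) + b tends to g when d → g and b → 0.
  let A : ℕ → Set (Cp X) := fun n =>
    {g | ∃ i, ∃ d ∈ D, ∀ x, g.1 x = d.1 x * (1 - (b n i).1 x) + (b n i).1 x}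
  have hA : ∀ n, A n ∈ SeqDenseSets (Cp X) := fun n => by
    refine isSeqDense_cp_iff.2 fun g => ?_
    obtain ⟨u, hu, hlim⟩ := hD g
    refine ⟨fun i => ⟨fun x => (u i).1 x * (1 - (b n i).1 x) + (b n i).1 x, ?_⟩, fun i => ?_,
      fun x => ?_⟩
    · exact ((u i).2.mul (continuous_const.sub (b n i).2)).add (b n i).2
    · exact ⟨i, u i, hu i, fun x => rfl⟩
    · refine (hlim x).congr' ((hb0 n x).mono fun i hi => ?_)
      simp [hi]
  obtain ⟨ℱ, hℱ, hΩ⟩ := h ⟨0, continuous_zero⟩ A hA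
  have hidx : ∀ n, ∀ g : Cp X, ∃ i, g ∈ A n → ∀ x ∉ U n i, g.1 x = 1 := fun n g => by
    by_cases hg : g ∈ A n
    · obtain ⟨i, d, -, hd⟩ := id hg
      exact ⟨i, fun _ x hx => by simp [hd, hb1 n i x hx]⟩
    · exact ⟨0, fun h => absurd h hg⟩
  choose idx hidx using hidx
  have hsub : ∀ n, ((fun g => U n (idx n g)) '' ℱ n).Finite ∧
      (fun g => U n (idx n g)) '' ℱ n ⊆ 𝒰 n := fun n =>
    ⟨(hℱ n).1.image _, Set.image_subset_iff.2 fun g _ => hU _ _⟩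
  have hω : ∀ K : Finset X, ∃ n, (K : Set X) ⊆ ⋃₀ ((fun g => U n (idx n g)) '' ℱ n) := by
    intro K
    obtain ⟨n, hn⟩ := hΩ K 1 one_pos
    refine ⟨n, fun x hx => ?_⟩
    obtain ⟨g, hg, hgx⟩ := hn x hx
    refine ⟨_, ⟨g, hg, rfl⟩, ?_⟩
    by_contra hxU
    rw [hidx n g ((hℱ n).2 hg) x hxU] at hgx
    simp at hgx
  refine ⟨fun n => (fun g => U n (idx n g)) '' ℱ n, hsub, ⟨?_, ?_⟩, ?_, fun K => ?_⟩
  · refine Set.eq_univ_of_forall fun x => ?_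
    obtain ⟨n, hn⟩ := hω {x}
    exact ⟨_, ⟨n, rfl⟩, hn (by simp)⟩
  · rintro ⟨n, hn⟩
    exact hnf n _ (hsub n).2 (hsub n).1 hn
  · rintro _ ⟨n, rfl⟩
    exact isOpen_sUnion fun V hV => ((h𝒰 n).2.1 V ((hsub n).2 hV)).isOpen
  · obtain ⟨n, hn⟩ := hω K
    exact ⟨_, ⟨n, rfl⟩, hn⟩

/-- Pointwise closeness to `f` within `ε` gives cozero-sets shrinkable to zero-sets. -/
theorem exists_subseq_mem_gammaFCovers {u : ℕ → Cp X} {f : Cp X}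
    (hu : ∀ x, Tendsto (fun i => (u i).1 x) atTop (𝓝 (f.1 x))) {ε : ℝ} (hε : 0 < ε)
    (hne : ∀ i, {x | |(u i).1 x - f.1 x| < ε} ≠ Set.univ) :
    ∃ φ : ℕ → ℕ, Set.range (fun i => {x | |(u (φ i)).1 x - f.1 x| < ε}) ∈ GammaFCovers X := by
  have hev : ∀ δ > 0, ∀ x, ∀ᶠ i in atTop, |(u i).1 x - f.1 x| < δ := fun δ hδ x =>
    (Metric.tendsto_nhds.1 (hu x) δ hδ).mono fun j hj => by rwa [Real.dist_eq] at hj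
  obtain ⟨φ, hφ⟩ := exists_injective_subseq (S := fun i => {x | |(u i).1 x - f.1 x| < ε})
    (hev ε hε) hne
  have hφt : Tendsto φ atTop atTop := (hφ.of_comp).nat_tendsto_atTop
  have hc : ∀ i, Continuous fun x => |(u i).1 x - f.1 x| := fun i => ((u i).2.sub f.2).abs
  refine ⟨φ, range_mem_gammaFCovers (Z := fun i => {x | |(u (φ i)).1 x - f.1 x| ≤ ε / 2}) hφ
    (fun i => ⟨fun x => max 0 (ε - |(u (φ i)).1 x - f.1 x|), ?_, ?_⟩)
    (fun i => ⟨fun x => max 0 (|(u (φ i)).1 x - f.1 x| - ε / 2), ?_, ?_⟩)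
    (fun i x hx => ?_) (fun x => ?_) fun i => hne (φ i)⟩
  · exact continuous_const.max (continuous_const.sub (hc _))
  · ext x
    simp
  · exact continuous_const.max ((hc _).sub continuous_const)
  · ext x
    simp
  · exact lt_of_le_of_lt hx (half_lt_self hε)
  · exact (hφt.eventually (hev _ (half_pos hε) x)).mono fun i hi => hi.le

theorem exists_finsets_of_uFinCovers (h : UFinCovers (GammaFCovers X) (OmegaCovers X)) (f : Cp X)
    {u : ℕ → ℕ → Cp X} (hu : ∀ n x, Tendsto (fun i => (u n i).1 x) atTop (𝓝 (f.1 x)))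
    {δ : ℕ → ℝ} (hδ : ∀ n, 0 < δ n) (hδ0 : Tendsto δ atTop (𝓝 0))
    (hcov : ∀ n, ¬ ∃ t : Finset ℕ, ∀ x, ∃ i ∈ t, |(u n i).1 x - f.1 x| < δ n) :
    ∃ t : ℕ → Finset ℕ, ∀ K : Finset X, ∀ ε : ℝ, 0 < ε → ∃ n, ∀ x ∈ K, ∃ i ∈ t n,
      |(u n i).1 x - f.1 x| < ε := by
  have hne : ∀ n i, {x | |(u n i).1 x - f.1 x| < δ n} ≠ Set.univ := fun n i hi =>
    hcov n ⟨{i}, fun x => ⟨i, by simp, Set.eq_univ_iff_forall.1 hi x⟩⟩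
  choose φ hφ using fun n => exists_subseq_mem_gammaFCovers (hu n) (hδ n) (hne n)
  have himg : ∀ n, ∀ ℱ ⊆ Set.range (fun i => {x | |(u n (φ n i)).1 x - f.1 x| < δ n}), ℱ.Finite →
      ∃ t : Finset ℕ, ∀ x ∈ ⋃₀ ℱ, ∃ i ∈ t, |(u n i).1 x - f.1 x| < δ n := by
    intro n ℱ hℱ hfin
    choose j hj using fun V : ℱ => hℱ V.2
    have : Finite ℱ := hfin
    refine ⟨(Set.finite_range fun V => φ n (j V)).toFinset, ?_⟩
    rintro x ⟨V, hV, hx⟩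
    refine ⟨φ n (j ⟨V, hV⟩), by simp, ?_⟩
    have := hj ⟨V, hV⟩
    simp only at this
    rw [← this] at hx
    exact hx
  have hnf : ∀ n, ∀ ℱ ⊆ Set.range (fun i => {x | |(u n (φ n i)).1 x - f.1 x| < δ n}), ℱ.Finite →
      ⋃₀ ℱ ≠ Set.univ := by
    intro n ℱ hℱ hfin huniv
    obtain ⟨t, ht⟩ := himg n ℱ hℱ hfin
    exact hcov n ⟨t, fun x => ht x (huniv ▸ Set.mem_univ x)⟩
  obtain ⟨ℱ, hℱ, -, -, hω⟩ := h _ hφ hnf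
  choose t ht using fun n => himg n (ℱ n) (hℱ n).2 (hℱ n).1
  -- Adding the missed points y k, k < m, to a finite set forces the ω-cover to answer at a stage n
  -- ≥ m, where δ n < ε.
  have hy : ∀ n, ∃ y, y ∉ ⋃₀ ℱ n := fun n => by
    by_contra! hall
    exact hnf n _ (hℱ n).2 (hℱ n).1 (Set.eq_univ_of_forall hall)
  choose y hy using hy
  refine ⟨t, fun K ε hε => ?_⟩
  obtain ⟨m, hm⟩ := eventually_atTop.1 (hδ0.eventually_lt_const hε)
  classical
  obtain ⟨_, ⟨n, rfl⟩, hn⟩ := hω (K ∪ (Finset.range m).image y)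
  have hmn : m ≤ n := by
    by_contra! hlt
    exact hy n (hn (by simpa using Or.inr ⟨n, hlt, rfl⟩))
  refine ⟨n, fun x hx => ?_⟩
  obtain ⟨i, hi, hix⟩ := ht n x (hn (by simp [hx]))
  exact ⟨i, hi, hix.trans (hm n hmn)⟩

theorem uFinCp_gammaAt_of_uFinCovers (h : UFinCovers (GammaFCovers X) (OmegaCovers X)) (f : Cp X) :
    UFinCp (GammaAt f) (OmegaAt f) := by
  intro A hA
  choose u huA hu using fun n => exists_seq_of_mem_gammaAt (hA n)
  have hu' : ∀ n x, Tendsto (fun i => (u n i).1 x) atTop (𝓝 (f.1 x)) := fun n =>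
    tendsto_cp_iff.1 (hu n)
  suffices hs : ∃ t : ℕ → Finset ℕ, ∀ K : Finset X, ∀ ε : ℝ, 0 < ε → ∃ n, ∀ x ∈ K, ∃ i ∈ t n,
      |(u n i).1 x - f.1 x| < ε by
    obtain ⟨t, ht⟩ := hs
    refine ⟨fun n => u n '' t n, fun n => ⟨(t n).finite_toSet.image _, ?_⟩, fun K ε hε => ?_⟩
    · exact Set.image_subset_iff.2 fun i _ => huA n i
    · obtain ⟨n, hn⟩ := ht K ε hε
      refine ⟨n, fun x hx => ?_⟩
      obtain ⟨i, hi, hix⟩ := hn x hx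
      exact ⟨u n i, ⟨i, hi, rfl⟩, hix⟩
  have hδ0 := tendsto_one_div_add_atTop_nhds_zero_nat (𝕜 := ℝ)
  -- The cover principle excludes covers with finite subcovers. Infinitely many such stages solve
  -- the problem alone; otherwise all of them lie below some N and are skipped.
  by_cases hfr : ∃ᶠ n : ℕ in atTop,
      ∃ t : Finset ℕ, ∀ x, ∃ i ∈ t, |(u n i).1 x - f.1 x| < 1 / ((n : ℝ) + 1)
  · have hex : ∀ n : ℕ, ∃ t : Finset ℕ,
        (∃ t : Finset ℕ, ∀ x, ∃ i ∈ t, |(u n i).1 x - f.1 x| < 1 / ((n : ℝ) + 1)) →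
          ∀ x, ∃ i ∈ t, |(u n i).1 x - f.1 x| < 1 / ((n : ℝ) + 1) := fun n => by
      by_cases hn : ∃ t : Finset ℕ, ∀ x, ∃ i ∈ t, |(u n i).1 x - f.1 x| < 1 / ((n : ℝ) + 1)
      · exact hn.imp fun t ht _ => ht
      · exact ⟨∅, fun h => absurd h hn⟩
    choose t ht using hex
    refine ⟨t, fun K ε hε => ?_⟩
    obtain ⟨n, hn, hnε⟩ := (hfr.and_eventually (hδ0.eventually_lt_const hε)).exists
    refine ⟨n, fun x _ => ?_⟩
    obtain ⟨i, hi, hix⟩ := ht n hn x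
    exact ⟨i, hi, hix.trans hnε⟩
  · obtain ⟨N, hN⟩ := eventually_atTop.1 (not_frequently.1 hfr)
    obtain ⟨t, ht⟩ := exists_finsets_of_uFinCovers h f (u := fun n => u (n + N))
      (δ := fun n => 1 / (((n + N : ℕ) : ℝ) + 1)) (fun n => hu' _) (fun n => by positivity)
      ((tendsto_add_atTop_iff_nat N).2 hδ0) fun n => hN (n + N) (Nat.le_add_left _ _)
    refine ⟨fun n => t (n - N), fun K ε hε => ?_⟩
    obtain ⟨n, hn⟩ := ht K ε hε
    exact ⟨n + N, by simpa using hn⟩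

end Selection

/-! ### From sequential separability to property V -/

section SeqSeparableToV

variable {X : Type v} [TopologicalSpace X]

theorem propertyV_of_isSeqSeparable [T35Space X] (hsep : IsSeqSeparable (Cp X)) :
    PropertyV X := by
  obtain ⟨D, hDc, hD⟩ := hsep
  rw [isSeqDense_cp_iff] at hD
  have hne : D.Nonempty := by
    obtain ⟨u, hu, -⟩ := hD ⟨0, continuous_zero⟩
    exact ⟨u 0, hu 0⟩
  obtain ⟨d, rfl⟩ := hDc.exists_eq_range hne
  let e : X → ℕ → ℝ := fun x k => (d k).1 x
  have he : Continuous e := continuous_pi fun k => (d k).2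
  have hinj : Function.Injective e := by
    intro x y hxy
    by_contra hne
    obtain ⟨g, hg, hg0, hg1⟩ := CompletelyRegularSpace.completely_regular x {y}
      isClosed_singleton hne
    have hgy : g y = 1 := hg1 rfl
    obtain ⟨u, hu, hlim⟩ := hD ⟨fun z => (g z : ℝ), continuous_subtype_val.comp hg⟩
    have hxy' : ∀ n, (u n).1 x = (u n).1 y := fun n => by
      obtain ⟨k, hk⟩ := hu n
      rw [← hk]
      exact congrFun hxy k
    have h1 := hlim x
    simp only [hxy'] at h1
    have h2 := tendsto_nhds_unique h1 (hlim y)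
    simp [hg0, hgy] at h2
  let _ : MetricSpace (ℕ → ℝ) := TopologicalSpace.metrizableSpaceMetric (ℕ → ℝ)
  have hsepY : TopologicalSpace.SeparableSpace (ULift.{v} (Set.range e)) :=
    (Homeomorph.ulift (X := Set.range e)).symm.surjective.denseRange.separableSpace
      (Homeomorph.ulift (X := Set.range e)).symm.continuous
  refine ⟨ULift.{v} (Set.range e), inferInstance, hsepY, fun x => ⟨⟨e x, x, rfl⟩⟩, ?_, ⟨?_, ?_⟩, ?_⟩
  · exact continuous_uliftUp.comp (he.subtype_mk _)
  · intro x y hxy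
    exact hinj (congrArg (fun z : ULift.{v} (Set.range e) => z.down.1) hxy)
  · rintro ⟨⟨_, x, rfl⟩⟩
    exact ⟨x, rfl⟩
  · rintro U ⟨g, hg, hU⟩
    have hUg : ∀ x, x ∈ U ↔ g x ≠ 0 := fun x => by
      rw [← not_iff_not, ← Set.mem_compl_iff, hU]
      simp
    obtain ⟨u, hu, hlim⟩ := hD ⟨g, hg⟩
    choose k hk using hu
    -- One n serves as both the starting index and the lower bound 1/(n+1), which passes to the
    -- limit |g x|.
    refine ⟨fun n => {y | ∀ j ≥ n, 1 / ((n : ℝ) + 1) ≤ |y.down.1 (k j)|}, fun n => ?_, ?_⟩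
    · have hc : ∀ j, Continuous fun y : ULift.{v} (Set.range e) => |y.down.1 (k j)| := fun j =>
        ((continuous_apply (k j)).comp (continuous_subtype_val.comp continuous_uliftDown)).abs
      simp only [Set.ofPred_forall]
      exact isClosed_iInter fun j => isClosed_iInter fun _ => isClosed_le continuous_const (hc j)
    · ext ⟨⟨_, x, rfl⟩⟩
      have hek : ∀ j, e x (k j) = (u j).1 x := fun j => congrArg (fun z : Cp X => z.1 x) (hk j)
      have hmem : (⟨⟨e x, x, rfl⟩⟩ : ULift.{v} (Set.range e)) ∈
          (fun x => (⟨⟨e x, x, rfl⟩⟩ : ULift.{v} (Set.range e))) '' U ↔ x ∈ U := by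
        constructor
        · rintro ⟨x', hx', h⟩
          have : x' = x := hinj (congrArg (fun z : ULift.{v} (Set.range e) => z.down.1) h)
          exact this ▸ hx'
        · exact fun hx => ⟨x, hx, rfl⟩
      rw [hmem, hUg]
      simp only [Set.mem_iUnion, Set.mem_ofPred_eq, hek]
      have habs := (hlim x).abs
      constructor
      · intro hx
        have h1 := habs.eventually_const_lt (half_lt_self (abs_pos.2 hx))
        have h2 := (tendsto_one_div_add_atTop_nhds_zero_nat (𝕜 := ℝ)).eventually_lt_const
          (half_pos (abs_pos.2 hx))
        obtain ⟨n, hn⟩ := eventually_atTop.1 (h1.and h2)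
        exact ⟨n, fun j hj => ((hn n le_rfl).2.trans (hn j hj).1).le⟩
      · rintro ⟨n, hn⟩ h0
        have h1 : 1 / ((n : ℝ) + 1) ≤ |g x| :=
          ge_of_tendsto habs ((eventually_ge_atTop n).mono hn)
        rw [h0, abs_zero] at h1
        have : (0 : ℝ) < 1 / ((n : ℝ) + 1) := by positivity
        linarith

end SeqSeparableToV

/-! ### From property V to sequential separability -/

section VToSeqSeparable

/-- Sets of real-valued functions that contain the rational constants and are closed under the
ring and lattice operations. -/
structure IsRationalLatticeRing {X : Type v} (T : Set (X → ℝ)) : Prop where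
  const_mem : ∀ q : ℚ, (fun _ => (q : ℝ)) ∈ T
  add_mem : ∀ a ∈ T, ∀ b ∈ T, a + b ∈ T
  mul_mem : ∀ a ∈ T, ∀ b ∈ T, a * b ∈ T
  sup_mem : ∀ a ∈ T, ∀ b ∈ T, a ⊔ b ∈ T
  inf_mem : ∀ a ∈ T, ∀ b ∈ T, a ⊓ b ∈ T

namespace IsRationalLatticeRing

variable {X : Type v} {T : Set (X → ℝ)}

theorem sub_mem (hT : IsRationalLatticeRing T) {a b : X → ℝ} (ha : a ∈ T) (hb : b ∈ T) :
    a - b ∈ T := by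
  convert hT.add_mem _ ha _ (hT.mul_mem _ (hT.const_mem (-1)) _ hb) using 1
  ext x
  simp [sub_eq_add_neg]

theorem sum_mem (hT : IsRationalLatticeRing T) {ι : Type*} (s : Finset ι) {a : ι → X → ℝ}
    (ha : ∀ i ∈ s, a i ∈ T) : ∑ i ∈ s, a i ∈ T := by
  refine Finset.sum_induction a (· ∈ T) (fun a b ha hb => hT.add_mem a ha b hb) ?_ ha
  convert hT.const_mem 0 using 1
  ext x
  simp

theorem prod_mem (hT : IsRationalLatticeRing T) {ι : Type*} (s : Finset ι) {a : ι → X → ℝ}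
    (ha : ∀ i ∈ s, a i ∈ T) : ∏ i ∈ s, a i ∈ T := by
  refine Finset.prod_induction a (· ∈ T) (fun a b ha hb => hT.mul_mem a ha b hb) ?_ ha
  convert hT.const_mem 1 using 1
  ext x
  simp

end IsRationalLatticeRing

theorem exists_countable_isRationalLatticeRing {X : Type v} [TopologicalSpace X] {S : Set (X → ℝ)}
    (hS : S.Countable) (hc : ∀ g ∈ S, Continuous g) :
    ∃ T : Set (X → ℝ), T.Countable ∧ S ⊆ T ∧ (∀ g ∈ T, Continuous g) ∧
      IsRationalLatticeRing T := by
  let step : Set (X → ℝ) → Set (X → ℝ) := fun A =>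
    A ∪ (Set.image2 (· + ·) A A ∪ Set.image2 (· * ·) A A) ∪
      (Set.image2 (· ⊔ ·) A A ∪ Set.image2 (· ⊓ ·) A A)
  let T : ℕ → Set (X → ℝ) := fun n =>
    step^[n] (S ∪ Set.range fun (q : ℚ) (_ : X) => (q : ℝ))
  have hsucc : ∀ n, T (n + 1) = step (T n) := fun n => Function.iterate_succ_apply' step n _
  have hmono : Monotone T := monotone_nat_of_le_succ fun n => by
    rw [hsucc]
    exact fun a ha => Or.inl (Or.inl ha)
  have hpair : ∀ a ∈ ⋃ n, T n, ∀ b ∈ ⋃ n, T n, ∃ n, a ∈ T n ∧ b ∈ T n := by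
    intro a ha b hb
    obtain ⟨m, hm⟩ := Set.mem_iUnion.1 ha
    obtain ⟨n, hn⟩ := Set.mem_iUnion.1 hb
    exact ⟨max m n, hmono (le_max_left _ _) hm, hmono (le_max_right _ _) hn⟩
  refine ⟨⋃ n, T n, Set.countable_iUnion fun n => ?_, fun a ha => ?_, fun g hg => ?_, ?_⟩
  · induction n with
    | zero => exact hS.union (Set.countable_range _)
    | succ n ih =>
      rw [hsucc]
      exact (ih.union ((ih.image2 ih _).union (ih.image2 ih _))).union
        ((ih.image2 ih _).union (ih.image2 ih _))
  · exact Set.mem_iUnion.2 ⟨0, Or.inl ha⟩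
  · obtain ⟨n, hn⟩ := Set.mem_iUnion.1 hg
    induction n generalizing g with
    | zero =>
      rcases hn with hn | ⟨q, rfl⟩
      · exact hc g hn
      · exact continuous_const
    | succ n ih =>
      rw [hsucc] at hn
      have ih' : ∀ a ∈ T n, Continuous a := fun a ha => ih a (Set.mem_iUnion.2 ⟨n, ha⟩) ha
      rcases hn with (h | ⟨a, ha, b, hb, rfl⟩ | ⟨a, ha, b, hb, rfl⟩) |
        ⟨a, ha, b, hb, rfl⟩ | ⟨a, ha, b, hb, rfl⟩
      · exact ih' g h
      · exact (ih' a ha).add (ih' b hb)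
      · exact (ih' a ha).mul (ih' b hb)
      · exact (ih' a ha).sup (ih' b hb)
      · exact (ih' a ha).inf (ih' b hb)
  · have hop : ∀ op : (X → ℝ) → (X → ℝ) → X → ℝ, (∀ n, ∀ a ∈ T n, ∀ b ∈ T n, op a b ∈ step (T n)) →
        ∀ a ∈ ⋃ n, T n, ∀ b ∈ ⋃ n, T n, op a b ∈ ⋃ n, T n := by
      intro op h a ha b hb
      obtain ⟨n, h1, h2⟩ := hpair a ha b hb
      exact Set.mem_iUnion.2 ⟨n + 1, by rw [hsucc]; exact h n a h1 b h2⟩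
    exact ⟨fun q => Set.mem_iUnion.2 ⟨0, Or.inr ⟨q, rfl⟩⟩,
      hop _ fun n a ha b hb => Or.inl (Or.inr (Or.inl ⟨a, ha, b, hb, rfl⟩)),
      hop _ fun n a ha b hb => Or.inl (Or.inr (Or.inr ⟨a, ha, b, hb, rfl⟩)),
      hop _ fun n a ha b hb => Or.inr (Or.inl ⟨a, ha, b, hb, rfl⟩),
      hop _ fun n a ha b hb => Or.inr (Or.inr ⟨a, ha, b, hb, rfl⟩)⟩

variable {X : Type v} {T : Set (X → ℝ)}

open Classical in
/-- The indicator of a set cut out by functions of `T` is an eventually constant limit of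
functions of `T`. -/
theorem exists_eventually_eq_indicator (hT : IsRationalLatticeRing T) {w : ℕ → X → ℝ}
    (hw : ∀ i, w i ∈ T) (hw0 : ∀ i x, 0 ≤ w i x) (I : Set ℕ) {C : Set X}
    (hC : ∀ x, x ∈ C ↔ ∀ i ∈ I, w i x = 0) :
    ∃ φ : ℕ → X → ℝ, (∀ n, φ n ∈ T) ∧ (∀ x ∈ C, ∀ n, φ n x = 1) ∧
      ∀ x ∉ C, ∀ᶠ n in atTop, φ n x = 0 := by
  -- The factors are max(0, 1 - n w_i) for i < n in I: exactly 1 on C, while off C one with w_i x >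
  -- 0 vanishes once n ≥ 1 / w_i x.
  refine ⟨fun n => ∏ i ∈ (Finset.range n).filter (· ∈ I),
    ((fun _ => ((0 : ℚ) : ℝ)) ⊔ ((fun _ => ((1 : ℚ) : ℝ)) - (fun _ => ((n : ℚ) : ℝ)) * w i)),
    fun n => hT.prod_mem _ fun i _ => ?_, fun x hx n => ?_, fun x hx => ?_⟩
  · exact hT.sup_mem _ (hT.const_mem 0) _
      (hT.sub_mem (hT.const_mem 1) (hT.mul_mem _ (hT.const_mem n) _ (hw i)))
  · beta_reduce
    rw [Finset.prod_apply]
    refine Finset.prod_eq_one fun i hi => ?_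
    simp [(hC x).1 hx i (Finset.mem_filter.1 hi).2]
  · rw [hC] at hx
    push Not at hx
    obtain ⟨i, hi, hix⟩ := hx
    have hpos : 0 < w i x := lt_of_le_of_ne (hw0 i x) hix.symm
    obtain ⟨m, hm⟩ := exists_nat_gt (1 / w i x)
    refine (eventually_ge_atTop (max m (i + 1))).mono fun n hn => ?_
    beta_reduce
    rw [Finset.prod_apply]
    refine Finset.prod_eq_zero (i := i) ?_ ?_
    · simpa using ⟨by omega, hi⟩
    · have h1 : (m : ℝ) ≤ n := by exact_mod_cast (le_max_left _ _).trans hn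
      have h2 : 1 ≤ (n : ℝ) * w i x := by
        rw [div_lt_iff₀ hpos] at hm
        nlinarith
      simpa using h2

/-- Selection of the value attached to the first set of a sequence that contains the point. -/
theorem exists_eventually_eq_value (hT : IsRationalLatticeRing T) {C : ℕ → Set X}
    (hcov : ∀ x, ∃ l, x ∈ C l) (c : ℕ → ℚ) {φ : ℕ → ℕ → X → ℝ} (hφ : ∀ l n, φ l n ∈ T)
    (hφ1 : ∀ l, ∀ x ∈ C l, ∀ n, φ l n x = 1) (hφ0 : ∀ l, ∀ x ∉ C l, ∀ᶠ n in atTop, φ l n x = 0) :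
    ∃ h : ℕ → X → ℝ, (∀ n, h n ∈ T) ∧ ∀ x, ∃ l, x ∈ C l ∧ ∀ᶠ n in atTop, h n x = c l := by
  classical
  -- At x with first index m, terms l > m vanish for every n since φ_m is exactly 1 on C m; only the
  -- finitely many l < m must be waited for.
  refine ⟨fun n => ∑ l ∈ Finset.range n, (fun _ => (c l : ℝ)) *
    (φ l n * ∏ k ∈ Finset.range l, ((fun _ => ((1 : ℚ) : ℝ)) - φ k n)),
    fun n => hT.sum_mem _ fun l _ => ?_, fun x => ⟨Nat.find (hcov x), Nat.find_spec (hcov x), ?_⟩⟩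
  · exact hT.mul_mem _ (hT.const_mem _) _ (hT.mul_mem _ (hφ l n) _
      (hT.prod_mem _ fun k _ => hT.sub_mem (hT.const_mem 1) (hφ k n)))
  · set m := Nat.find (hcov x) with hm
    have hev : ∀ᶠ n in atTop, ∀ k ∈ Finset.range m, φ k n x = 0 :=
      (Finset.eventually_all _).2 fun k hk =>
        hφ0 k x (Nat.find_min (hcov x) (Finset.mem_range.1 hk))
    have hmC : x ∈ C m := Nat.find_spec (hcov x)
    filter_upwards [hev, eventually_gt_atTop m] with n hn hmn
    rw [Finset.sum_apply, Finset.sum_eq_single m]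
    · have : ∏ k ∈ Finset.range m, (1 - φ k n x) = 1 :=
        Finset.prod_eq_one fun k hk => by rw [hn k hk, sub_zero]
      simp [Finset.prod_apply, this, hφ1 m x hmC n]
    · intro l _ hlm
      rcases lt_or_gt_of_ne hlm with hlt | hgt
      · simp [hn l (Finset.mem_range.2 hlt)]
      · have : ∏ k ∈ Finset.range l, (1 - φ k n x) = 0 :=
          Finset.prod_eq_zero (Finset.mem_range.2 hgt) (by rw [hφ1 m x hmC n, sub_self])
        simp [Finset.prod_apply, this]
    · intro h
      exact absurd (Finset.mem_range.2 hmn) h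

/-- Truncating increments turns uniformly convergent eventually constant limits of functions of `T`
into a limit of functions of `T`. -/
theorem exists_tendsto_of_uniform_approx (hT : IsRationalLatticeRing T) {g : X → ℝ}
    {h : ℕ → ℕ → X → ℝ} (hh : ∀ N n, h N n ∈ T)
    (hg : ∀ N x, ∃ c, |c - g x| ≤ (1 / 2) ^ N ∧ ∀ᶠ n in atTop, h N n x = c) :
    ∃ H : ℕ → X → ℝ, (∀ n, H n ∈ T) ∧ ∀ x, Tendsto (fun n => H n x) atTop (𝓝 (g x)) := by
  choose c hcg hc using hg
  -- The time at which h N settles at x depends on N, so the diagonal h n n need not converge;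
  -- clamping increments controls the unsettled levels. As |c (N+1) - c N| ≤ (3/2)(1/2)^N, the bound
  -- 2(1/2)^N is inactive once the values have settled.
  let ε : ℕ → X → ℝ := fun N _ => ((2 * (1 / 2) ^ N : ℚ) : ℝ)
  let K : ℕ → ℕ → X → ℝ := fun n N => Nat.rec (h 0 n)
    (fun N k => (k - ε N) ⊔ ((k + ε N) ⊓ h (N + 1) n)) N
  have hKs : ∀ n N x, K n (N + 1) x =
      max (K n N x - 2 * (1 / 2) ^ N) (min (K n N x + 2 * (1 / 2) ^ N) (h (N + 1) n x)) := by
    intro n N x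
    simp [K, ε]
  have hKT : ∀ n N, K n N ∈ T := by
    intro n N
    induction N with
    | zero => exact hh 0 n
    | succ N ih =>
      exact hT.sup_mem _ (hT.sub_mem ih (hT.const_mem _)) _
        (hT.inf_mem _ (hT.add_mem _ ih _ (hT.const_mem _)) _ (hh _ _))
  have hstep : ∀ n N x, |K n (N + 1) x - K n N x| ≤ 2 * (1 / 2) ^ N := by
    intro n N x
    have hp : (0 : ℝ) < (1 / 2) ^ N := by positivity
    rw [hKs, abs_le]
    constructor
    · linarith [le_max_left (K n N x - 2 * (1 / 2) ^ N)
        (min (K n N x + 2 * (1 / 2) ^ N) (h (N + 1) n x))]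
    · have := max_le (a := K n N x - 2 * (1 / 2) ^ N)
        (b := min (K n N x + 2 * (1 / 2) ^ N) (h (N + 1) n x)) (c := K n N x + 2 * (1 / 2) ^ N)
        (by linarith) (min_le_left _ _)
      linarith
  have htail : ∀ n M j x, |K n (M + j) x - K n M x| ≤ 4 * (1 / 2) ^ M - 4 * (1 / 2) ^ (M + j) := by
    intro n M j x
    induction j with
    | zero => simp
    | succ j ih =>
      have h1 := abs_sub_le (K n (M + (j + 1)) x) (K n (M + j) x) (K n M x)
      have h2 := hstep n (M + j) x
      have h3 : ((1 : ℝ) / 2) ^ (M + (j + 1)) = (1 / 2) ^ (M + j) / 2 := by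
        rw [← add_assoc, pow_succ]; ring
      rw [← add_assoc] at h1 h3 ⊢
      rw [h3]
      linarith
  have hev : ∀ M x, ∀ᶠ n in atTop, K n M x = c M x := by
    intro M x
    induction M with
    | zero => exact hc 0 x
    | succ M ih =>
      filter_upwards [ih, hc (M + 1) x] with n h1 h2
      have h3 := abs_le.1 (hcg M x)
      have h4 := abs_le.1 (hcg (M + 1) x)
      have h5 : ((1 : ℝ) / 2) ^ (M + 1) = (1 / 2) ^ M / 2 := by rw [pow_succ]; ring
      have hp : (0 : ℝ) < (1 / 2) ^ M := by positivity
      rw [h5] at h4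
      rw [hKs, h1, h2, min_eq_right (by linarith), max_eq_right (by linarith)]
  refine ⟨fun n => K n n, fun n => hKT n n, fun x => Metric.tendsto_nhds.2 fun δ hδ => ?_⟩
  -- The clamped tail after level M costs at most 4(1/2)^M, and c M is within (1/2)^M of g x: five
  -- in all.
  obtain ⟨M, hM⟩ := exists_pow_lt_of_lt_one (show 0 < δ / 5 by linarith) (one_half_lt_one (α := ℝ))
  filter_upwards [hev M x, eventually_ge_atTop M] with n hn hMn
  obtain ⟨j, rfl⟩ := Nat.exists_eq_add_of_le hMn
  have h1 := htail (M + j) M j x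
  have h2 := hcg M x
  rw [hn] at h1
  have hp : (0 : ℝ) < (1 / 2) ^ (M + j) := by positivity
  rw [Real.dist_eq]
  have h3 := abs_sub_le (K (M + j) (M + j) x) (c M x) (g x)
  linarith

theorem isCozeroSet_abs_sub_lt [TopologicalSpace X] {g : X → ℝ} (hg : Continuous g) (q ε : ℝ) :
    IsCozeroSet {x | |g x - q| < ε} := by
  refine ⟨fun x => max 0 (ε - |g x - q|),
    continuous_const.max (continuous_const.sub (hg.sub continuous_const).abs), ?_⟩
  ext x
  simp

/-- The closed sets of a nonempty separable metric space are cut out by countably many fixed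
nonnegative continuous functions. -/
theorem exists_seq_cutting_out_closed (Y : Type v) [MetricSpace Y]
    [TopologicalSpace.SeparableSpace Y] [Nonempty Y] :
    ∃ w : ℕ → Y → ℝ, (∀ i, Continuous (w i)) ∧ (∀ i y, 0 ≤ w i y) ∧
      ∀ C : Set Y, IsClosed C → ∃ I : Set ℕ, ∀ y, y ∈ C ↔ ∀ i ∈ I, w i y = 0 := by
  let s := TopologicalSpace.denseSeq Y
  let e := Denumerable.eqv (ℕ × ℚ)
  refine ⟨fun i y => max 0 (((e.symm i).2 : ℝ) - dist y (s (e.symm i).1)),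
    fun i => continuous_const.max (continuous_const.sub (continuous_id.dist continuous_const)),
    fun i y => le_max_left _ _, fun C hC => ?_⟩
  refine ⟨{i | ∀ y ∈ C, max 0 (((e.symm i).2 : ℝ) - dist y (s (e.symm i).1)) = 0},
    fun y => ⟨fun hy i hi => hi y hy, fun h => ?_⟩⟩
  by_contra hy
  obtain ⟨δ, hδ, hball⟩ := Metric.isOpen_iff.1 hC.isOpen_compl y hy
  obtain ⟨k, hk⟩ := (TopologicalSpace.denseRange_denseSeq Y).exists_dist_lt y
    (show 0 < δ / 3 by linarith)
  change dist y (s k) < δ / 3 at hk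
  -- The ball of radius q about s k contains y since q > δ/3, and misses C since points of C are at
  -- distance over 2δ/3 from s k.
  obtain ⟨q, hq1, hq2⟩ := exists_rat_btwn (show δ / 3 < 2 * δ / 3 by linarith)
  have := h (e (k, q)) fun z hz => by
    have hz' : δ ≤ dist z y := by
      by_contra! hlt
      exact hball hlt hz
    have := dist_triangle z (s k) y
    rw [dist_comm (s k) y] at this
    simp only [Equiv.symm_apply_apply]
    exact max_eq_left (by linarith)
  simp only [Equiv.symm_apply_apply] at this
  have h2 := le_max_right 0 ((q : ℝ) - dist y (s k))
  rw [this] at h2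
  linarith

/-- The closed pieces depend on g, but their indicators are limits from one countable ring, since
only the index set `I` varies with the piece. -/
theorem isSeqSeparable_of_propertyV [TopologicalSpace X] (hV : PropertyV X) :
    IsSeqSeparable (Cp X) := by
  rcases isEmpty_or_nonempty X with hX | hX
  · exact ⟨Set.univ, Set.countable_univ_iff.2 inferInstance, isSeqDense_cp_iff.2 fun g =>
      ⟨fun _ => g, fun _ => trivial, fun x => tendsto_const_nhds⟩⟩
  obtain ⟨Y, _, _, f, hf, hbij, hfσ⟩ := hV
  have : Nonempty Y := hX.map f
  obtain ⟨w, hwc, hw0, hwC⟩ := exists_seq_cutting_out_closed Y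
  obtain ⟨T, hTc, hwT, hTcont, hT⟩ := exists_countable_isRationalLatticeRing
    (S := Set.range fun i x => w i (f x)) (Set.countable_range _)
    (Set.forall_mem_range.2 fun i => (hwc i).comp hf)
  refine ⟨{g | g.1 ∈ T}, hTc.preimage Subtype.val_injective, isSeqDense_cp_iff.2 fun g => ?_⟩
  have key : ∀ N : ℕ, ∃ h : ℕ → X → ℝ, (∀ n, h n ∈ T) ∧
      ∀ x, ∃ c, |c - g.1 x| ≤ (1 / 2) ^ N ∧ ∀ᶠ n in atTop, h n x = c := by
    intro N
    -- The closed pieces of the images of {|g - q| < (1/2)^N}, over rational q, cover `Y`; on each,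
    -- q approximates g.
    choose C hCcl hCU using fun q : ℚ => hfσ _ (isCozeroSet_abs_sub_lt g.2 q ((1 / 2) ^ N))
    let e := Denumerable.eqv (ℚ × ℕ)
    let B : ℕ → Set X := fun l => f ⁻¹' C (e.symm l).1 (e.symm l).2
    have hB : ∀ l, ∃ φ : ℕ → X → ℝ, (∀ n, φ n ∈ T) ∧ (∀ x ∈ B l, ∀ n, φ n x = 1) ∧
        ∀ x ∉ B l, ∀ᶠ n in atTop, φ n x = 0 := fun l => by
      obtain ⟨I, hI⟩ := hwC _ (hCcl (e.symm l).1 (e.symm l).2)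
      exact exists_eventually_eq_indicator hT (w := fun i x => w i (f x)) (fun i => hwT ⟨i, rfl⟩)
        (fun i x => hw0 i _) I fun x => hI (f x)
    choose φ hφT hφ1 hφ0 using hB
    have hcov : ∀ x, ∃ l, x ∈ B l := fun x => by
      obtain ⟨q, hq1, hq2⟩ := exists_rat_btwn
        (show g.1 x < g.1 x + (1 / 2) ^ N from lt_add_of_pos_right _ (by positivity))
      have hx : f x ∈ f '' {x | |g.1 x - q| < (1 / 2) ^ N} :=
        ⟨x, show |g.1 x - q| < (1 / 2) ^ N from abs_lt.2 ⟨by linarith, by linarith⟩, rfl⟩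
      rw [hCU q] at hx
      obtain ⟨m, hm⟩ := Set.mem_iUnion.1 hx
      exact ⟨e (q, m), by simpa [B] using hm⟩
    obtain ⟨h, hhT, hh⟩ := exists_eventually_eq_value hT hcov (fun l => (e.symm l).1) hφT hφ1 hφ0
    refine ⟨h, hhT, fun x => ?_⟩
    obtain ⟨l, hl, hev⟩ := hh x
    refine ⟨_, ?_, hev⟩
    have hx : f x ∈ f '' {x | |g.1 x - ((e.symm l).1 : ℚ)| < (1 / 2) ^ N} := by
      rw [hCU]
      exact Set.mem_iUnion.2 ⟨_, hl⟩
    obtain ⟨x', hx', hxx⟩ := hx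
    rw [hbij.1 hxx] at hx'
    rw [abs_sub_comm]
    exact le_of_lt hx'
  choose h hhT hh using key
  obtain ⟨H, hHT, hH⟩ := exists_tendsto_of_uniform_approx hT hhT hh
  exact ⟨fun n => ⟨H n, hTcont _ (hHT n)⟩, hHT, hH⟩

end VToSeqSeparable

end SelectionCp

theorem mainTheorem6 (X : Type*) [TopologicalSpace X] [T35Space X] :
    List.TFAE [
      SelectionCp.UFinCp (SelectionCp.SeqDenseSets (SelectionCp.Cp X))
          (SelectionCp.DenseSequences X) ∧
        SelectionCp.IsSeqSeparable (SelectionCp.Cp X),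
      SelectionCp.UFinCovers (SelectionCp.GammaFCovers X) (SelectionCp.OmegaCovers X) ∧
        SelectionCp.PropertyV X,
      (∀ f : SelectionCp.Cp X,
          SelectionCp.UFinCp (SelectionCp.GammaAt f) (SelectionCp.OmegaAt f)) ∧
        SelectionCp.IsSeqSeparable (SelectionCp.Cp X),
      (∀ f : SelectionCp.Cp X,
          SelectionCp.UFinCp (SelectionCp.SeqDenseSets (SelectionCp.Cp X))
            (SelectionCp.OmegaAt f)) ∧
        SelectionCp.IsSeqSeparable (SelectionCp.Cp X)] := by
  tfae_have 1 → 4 := fun ⟨h, hs⟩ => ⟨fun f A hA => by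
    obtain ⟨ℱ, hℱ, hD⟩ := h A hA
    exact ⟨ℱ, hℱ, hD f⟩, hs⟩
  tfae_have 4 → 1 := fun ⟨h, hs⟩ => ⟨SelectionCp.uFinCp_denseSequences hs h, hs⟩
  tfae_have 4 → 2 := fun ⟨h, hs⟩ => ⟨SelectionCp.uFinCovers_of_seqDenseSets hs h,
    SelectionCp.propertyV_of_isSeqSeparable hs⟩
  tfae_have 2 → 3 := fun ⟨h, hV⟩ => ⟨SelectionCp.uFinCp_gammaAt_of_uFinCovers h,
    SelectionCp.isSeqSeparable_of_propertyV hV⟩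
  tfae_have 3 → 4 := fun ⟨h, hs⟩ =>
    ⟨fun f => SelectionCp.uFinCp_seqDenseSets_of_gammaAt f (h f), hs⟩
  tfae_finish
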